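/- Let $b>1$ be an integer and let $A\subset\{0,1,\dots,b-1\}$ contain at least one non-zero digit. Put $N=\#A$, $s_0=\log_b N$ and $\gamma_j=\sum_{a\in A}a^j$. A positive integer is admissible if all the digits of its (minimal) radix-$b$ representation belong to $A$. The restricted Dirichlet series $$K(s)=\sum_{\substack{n>0\\ n\ \text{admissible}}} n^{-s}\qquad(\Re s>s_0)$$ converges and has a meromorphic continuation to the whole complex plane, still denoted $K(s)$. For $m\in\mathbb N=\{0,1,2,\dots\}$ and $k\in\mathbb Z$ let $s_{m,k}=s_0-m+\frac{2\pi i k}{\log b}$, and let $\lambda_{m,k}$ be the residue (perhaps vanishing) of $K(s)$ at $s_{m,k}$. Then for all $m\ge1$ and $k\in\mathbb Z$ $$(1-b^{-m})\,\lambda_{m,k}=-\frac1N\sum_{j=1}^m\frac{(m-s_{0,k})(m-1-s_{0,k})\cdots(m-j+1-s_{0,k})}{j!}\,\frac{\gamma_j}{b^j}\,\lambda_{m-j,k}.$$ Moreover, for every $k\in\mathbb Z$, one has $\lambda_{0,k}=0$ if and only if $s_{0,k}$ is not a pole of $K$, and in that case $s_{m,k}$ is not a pole of $K$ for any $m\ge1$.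 -/

import Mathlib

open Filter Topology

noncomputable section

/-- `n` is admissible when every digit of its minimal radix-`b` representation lies in `A`. -/
def Admissible (b : ℕ) (A : Finset ℕ) (n : ℕ) : Prop :=
  ∀ d ∈ Nat.digits b n, d ∈ A

/-- Coefficients of the restricted Dirichlet series `K(s) = ∑'_{n > 0} n ^ (-s)`
(the term of index `0` is ignored by Mathlib's `LSeries`). -/
def admissibleCoeff (b : ℕ) (A : Finset ℕ) : ℕ → ℂ :=
  Set.indicator {n : ℕ | Admissible b A n} (fun _ => 1)

/-- The abscissa of convergence `s₀ = log_b N`, where `N` is the number of admissible digits. -/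
def abscissa (b : ℕ) (A : Finset ℕ) : ℝ :=
  Real.logb b A.card

/-- `K` is a meromorphic continuation to the whole plane of the restricted Dirichlet series:
it is meromorphic on `ℂ`, and it is the sum of the series for `Re s > s₀`. -/
structure IsRestrictedDirichlet (b : ℕ) (A : Finset ℕ) (K : ℂ → ℂ) : Prop where
  meromorphic : MeromorphicOn K Set.univ
  hasSum : ∀ s : ℂ, abscissa b A < s.re → LSeriesHasSum (admissibleCoeff b A) s (K s)

/-- The point `s_{m,k} = s₀ - m + 2πik / log b`. -/
def latticePoint (b : ℕ) (A : Finset ℕ) (m : ℕ) (k : ℤ) : ℂ :=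
  (abscissa b A : ℂ) - m + k * (2 * Real.pi * Complex.I / Real.log b)

/-- The power sums `γ_j = ∑_{a ∈ A} a ^ j` over the admissible digits. -/
def digitPowerSum (A : Finset ℕ) (j : ℕ) : ℂ :=
  ∑ a ∈ A, (a : ℂ) ^ j

/-- The residue of `f` at the isolated singularity `z`: the common value of
`(2πi)⁻¹ ∮ f(w) dw` over all sufficiently small circles centred at `z`. -/
def complexResidue (f : ℂ → ℂ) (z : ℂ) : ℂ :=
  limUnder (𝓝[>] (0 : ℝ)) fun r => (2 * Real.pi * Complex.I)⁻¹ * ∮ w in C(z, r), f w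

/-- `z` is a pole of the meromorphic function `f`. -/
def IsPoleOf (f : ℂ → ℂ) (z : ℂ) : Prop :=
  meromorphicOrderAt f z < 0

end

/-! Every positive integer is either a nonzero digit or `b * n + a` with `n > 0` and `a` its last
digit. Splitting the series accordingly and expanding `(1 + a / (b n)) ^ (-s)` by the binomial
theorem gives `K(s) = D(s) + b^(-s) ∑_j binom(-s, j) (γ_j / b^j) K(s + j)`, with `D` entire
(`lseries_eq_digitSum_add`). The term `j = 0` is `N b^(-s) K(s)`. Moved to the left, it leaves `(1 -
N b^(-s)) K(s)` expressed through values of `K` at least one unit further right, so `K` extends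
strip by strip.

At `s_{m,k}` one has `N b^(-s) = b^m`. For `m = 0` the factor `1 - N b^(-s)` has a simple zero,
which gives at most a simple pole. For `m ≥ 1` it is the nonzero number `1 - b^m`, so the polar part
of `K` at `s_{m,k}` comes only from `K(s + j)` with `1 ≤ j ≤ m`, that is, from the points
`s_{m-j,k}`. Comparing residues gives the recursion (`hasSimplePoleAt_latticePoint_of_lt`,
`complexResidue_recursion`). Since all these poles are at most simple, a zero residue means no pole,
and the recursion propagates `λ_{0,k} = 0` to every `m`.

An arbitrary continuation agrees with the constructed one on punctured neighbourhoods, which is all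
that residues and poles depend on. -/

/-! ### Calculus of poles that are at most simple. -/

/-- Near `z`, the function `f` is `g(w) / (w - z)` with `g` analytic and `g z = c`: it has at most
a simple pole at `z`, with residue `c`. -/
def HasSimplePoleAt (f : ℂ → ℂ) (z c : ℂ) : Prop :=
  ∃ g : ℂ → ℂ, AnalyticAt ℂ g z ∧ g z = c ∧ ∀ᶠ w in 𝓝[≠] z, f w = g w / (w - z)

namespace HasSimplePoleAt

variable {f f₁ f₂ : ℂ → ℂ} {z c c₁ c₂ : ℂ}

theorem congr (h : HasSimplePoleAt f₁ z c) (e : f₂ =ᶠ[𝓝[≠] z] f₁) : HasSimplePoleAt f₂ z c := by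
  obtain ⟨g, hg, hc, h⟩ := h
  exact ⟨g, hg, hc, by filter_upwards [e, h] with w h₁ h₂ using h₁.trans h₂⟩

theorem of_analyticAt (h : AnalyticAt ℂ f z) : HasSimplePoleAt f z 0 := by
  refine ⟨fun w => (w - z) * f w, by fun_prop, by simp, ?_⟩
  filter_upwards [self_mem_nhdsWithin] with w hw
  rw [mul_div_cancel_left₀ _ (sub_ne_zero.2 hw)]

theorem add (h₁ : HasSimplePoleAt f₁ z c₁) (h₂ : HasSimplePoleAt f₂ z c₂) :
    HasSimplePoleAt (fun w => f₁ w + f₂ w) z (c₁ + c₂) := by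
  obtain ⟨g₁, hg₁, rfl, h₁⟩ := h₁
  obtain ⟨g₂, hg₂, rfl, h₂⟩ := h₂
  refine ⟨fun w => g₁ w + g₂ w, by fun_prop, rfl, ?_⟩
  filter_upwards [h₁, h₂] with w h₁ h₂
  rw [h₁, h₂, add_div]

theorem sum {ι : Type*} (s : Finset ι) {f : ι → ℂ → ℂ} {c : ι → ℂ}
    (h : ∀ i ∈ s, HasSimplePoleAt (f i) z (c i)) :
    HasSimplePoleAt (fun w => ∑ i ∈ s, f i w) z (∑ i ∈ s, c i) := by
  classical
  induction s using Finset.induction_on with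
  | empty => simpa using of_analyticAt (f := fun _ => (0 : ℂ)) analyticAt_const
  | insert i s hi ih =>
    simp only [Finset.sum_insert hi]
    exact (h i (Finset.mem_insert_self i s)).add
      (ih fun j hj => h j (Finset.mem_insert_of_mem hj))

theorem analyticAt_mul (h : HasSimplePoleAt f z c) {a : ℂ → ℂ} (ha : AnalyticAt ℂ a z) :
    HasSimplePoleAt (fun w => a w * f w) z (a z * c) := by
  obtain ⟨g, hg, rfl, h⟩ := h
  refine ⟨fun w => a w * g w, by fun_prop, rfl, ?_⟩
  filter_upwards [h] with w h
  rw [h, mul_div_assoc]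

theorem comp_add_const {d : ℂ} (h : HasSimplePoleAt f (z + d) c) :
    HasSimplePoleAt (fun w => f (w + d)) z c := by
  obtain ⟨g, hg, rfl, h⟩ := h
  refine ⟨fun w => g (w + d), ?_, rfl, ?_⟩
  · exact AnalyticAt.fun_comp (g := g) (f := fun w => w + d) hg (by fun_prop)
  · have ht : Tendsto (fun w => w + d) (𝓝[≠] z) (𝓝[≠] (z + d)) := by
      refine tendsto_nhdsWithin_iff.2 ⟨?_, ?_⟩
      · exact ((continuous_id.add continuous_const).tendsto z).mono_left nhdsWithin_le_nhds
      · filter_upwards [self_mem_nhdsWithin] with w hw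
        simpa using hw
    filter_upwards [ht.eventually h] with w hw
    rw [hw, add_sub_add_right_eq_sub]

/-- `d w = (w - z) * dslope d z w`, where the slope is analytic and takes the nonzero value `deriv d
z` at `z`. -/
theorem inv_mul_of_simple_zero {d h : ℂ → ℂ} (hd : AnalyticAt ℂ d z) (h₀ : d z = 0)
    (h₁ : deriv d z ≠ 0) (hh : AnalyticAt ℂ h z) :
    HasSimplePoleAt (fun w => (d w)⁻¹ * h w) z ((deriv d z)⁻¹ * h z) := by
  have hs : AnalyticAt ℂ (dslope d z) z := by
    obtain ⟨p, hp⟩ := hd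
    exact hp.has_fpower_series_dslope_fslope.analyticAt
  refine ⟨fun w => (dslope d z w)⁻¹ * h w, ?_, by simp [dslope_same], ?_⟩
  · exact (hs.inv (by rwa [dslope_same])).mul hh
  · refine Eventually.of_forall fun w => ?_
    have := sub_smul_dslope d z w
    rw [h₀, sub_zero, smul_eq_mul] at this
    change (d w)⁻¹ * h w = (dslope d z w)⁻¹ * h w / (w - z)
    rw [← this, mul_inv]
    ring

theorem meromorphicAt (h : HasSimplePoleAt f z c) : MeromorphicAt f z := by
  obtain ⟨g, hg, -, h⟩ := h
  refine MeromorphicAt.congr (f := fun w => g w / (w - z)) ?_ (h.mono fun w hw => hw.symm)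
  exact hg.meromorphicAt.div (by fun_prop)

/-- If `g z = 0`, then `g w / (w - z)` is the slope of `g`, which is analytic, so the singularity is
removable. Otherwise the order is exactly `-1`. -/
theorem isPoleOf_iff (h : HasSimplePoleAt f z c) : IsPoleOf f z ↔ c ≠ 0 := by
  have hm := h.meromorphicAt
  obtain ⟨g, hg, rfl, h⟩ := h
  constructor
  · intro hp h₀
    have hs : AnalyticAt ℂ (dslope g z) z := by
      obtain ⟨p, hp⟩ := hg
      exact hp.has_fpower_series_dslope_fslope.analyticAt
    have e : f =ᶠ[𝓝[≠] z] dslope g z := by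
      filter_upwards [h, self_mem_nhdsWithin] with w hw hne
      have := sub_smul_dslope g z w
      rw [h₀, sub_zero, smul_eq_mul] at this
      rw [hw, ← this, mul_div_cancel_left₀ _ (sub_ne_zero.2 hne)]
    rw [IsPoleOf, meromorphicOrderAt_congr e] at hp
    exact absurd hs.meromorphicOrderAt_nonneg (not_le.2 hp)
  · intro h₀
    have : meromorphicOrderAt f z = ((-1 : ℤ) : WithTop ℤ) := by
      refine (meromorphicOrderAt_eq_int_iff hm).2 ⟨g, hg, h₀, ?_⟩
      filter_upwards [h] with w hw
      rw [hw, zpow_neg_one, smul_eq_mul, div_eq_inv_mul]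
    rw [IsPoleOf, this]
    exact_mod_cast (by norm_num : (-1 : ℤ) < 0)

/-- By Cauchy's integral formula the normalised integral is constant for all small radii, so the
limit is this constant. -/
theorem complexResidue_eq (h : HasSimplePoleAt f z c) : complexResidue f z = c := by
  obtain ⟨g, hg, rfl, h⟩ := h
  refine Tendsto.limUnder_eq (tendsto_const_nhds.congr' ?_)
  have h' := eventually_nhdsWithin_iff.1 h
  obtain ⟨ε, hε, hball⟩ := Metric.eventually_nhds_iff.1 (h'.and hg.eventually_analyticAt)
  filter_upwards [Ioo_mem_nhdsGT hε] with r hr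
  have hg' : DifferentiableOn ℂ g (Metric.closedBall z r) := fun w hw =>
    (hball ((Metric.mem_closedBall.1 hw).trans_lt hr.2)).2.differentiableAt.differentiableWithinAt
  have hcauchy := hg'.circleIntegral_sub_inv_smul (Metric.mem_ball_self hr.1)
  have e : (∮ w in C(z, r), f w) = ∮ w in C(z, r), (w - z)⁻¹ • g w := by
    refine circleIntegral.integral_congr hr.1.le fun w hw => ?_
    have hd : dist w z = r := hw
    have hne : w ≠ z := by
      rintro rfl
      rw [dist_self] at hd
      exact hr.1.ne hd
    simp only [(hball (hd.trans_lt hr.2)).1 hne, smul_eq_mul, div_eq_inv_mul]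
  rw [e, hcauchy, smul_eq_mul, inv_mul_cancel_left₀ Complex.two_pi_I_ne_zero]

end HasSimplePoleAt

/-! ### Identity theorem for meromorphic functions. -/

/-- Two meromorphic functions on the plane that agree on a nonempty open set agree off a discrete
set. -/
theorem MeromorphicOn.eventuallyEq_nhdsNE {f g : ℂ → ℂ} (hf : MeromorphicOn f Set.univ)
    (hg : MeromorphicOn g Set.univ) {z₀ : ℂ} (h : f =ᶠ[𝓝 z₀] g) (z : ℂ) : f =ᶠ[𝓝[≠] z] g := by
  have hs : MeromorphicOn (f - g) Set.univ := hf.sub hg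
  have h₀ : meromorphicOrderAt (f - g) z₀ = ⊤ := by
    refine meromorphicOrderAt_eq_top_iff.2 ((h.filter_mono nhdsWithin_le_nhds).mono fun w hw => ?_)
    simp [hw]
  -- On a connected set a meromorphic function of infinite order at one point has infinite order
  -- everywhere.
  have hz : meromorphicOrderAt (f - g) z = ⊤ := by
    by_contra hne
    exact hs.meromorphicOrderAt_ne_top_of_isPreconnected isPreconnected_univ (Set.mem_univ z)
      (Set.mem_univ z₀) hne h₀
  exact (meromorphicOrderAt_eq_top_iff.1 hz).mono fun w hw => sub_eq_zero.1 hw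

/-! ### Binomial series and bounds for its coefficients. -/

/-- The binomial coefficient `-s` over `j`. -/
noncomputable def chooseNeg (s : ℂ) (j : ℕ) : ℂ :=
  (∏ i ∈ Finset.range j, (-s - i)) / (j.factorial : ℂ)

/-- Links the product form, convenient for norm bounds and analyticity in `s`, to the coefficients
of Mathlib's binomial series. -/
theorem chooseNeg_eq_ringChoose (s : ℂ) (j : ℕ) : chooseNeg s j = Ring.choose (-s) j := by
  have h : (descPochhammer ℤ j).smeval (-s) = ∏ i ∈ Finset.range j, (-s - i) := by
    induction j with
    | zero => simp
    | succ j ih =>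
      rw [descPochhammer_succ_right, Polynomial.smeval_mul, ih, Finset.prod_range_succ]
      simp [Polynomial.smeval_sub, Polynomial.smeval_natCast]
  rw [Ring.choose_eq_smul, h, chooseNeg, div_eq_inv_mul, smul_eq_mul]

@[simp] theorem chooseNeg_zero (s : ℂ) : chooseNeg s 0 = 1 := by simp [chooseNeg]

theorem hasSum_chooseNeg_mul_pow (s : ℂ) {x : ℂ} (hx : ‖x‖ < 1) :
    HasSum (fun j => chooseNeg s j * x ^ j) ((1 + x) ^ (-s)) := by
  have h := (Complex.one_add_cpow_hasFPowerSeriesOnBall_zero (a := -s)).hasSum (y := x)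
    (by simpa [← ENNReal.ofReal_one, Metric.eball_ofReal] using hx)
  simp only [zero_add, binomialSeries_apply, List.ofFn_const, List.prod_replicate,
    smul_eq_mul] at h
  simpa only [chooseNeg_eq_ringChoose] using h

theorem norm_chooseNeg_le {s : ℂ} {R : ℝ} (hs : ‖s‖ ≤ R) (j : ℕ) :
    ‖chooseNeg s j‖ ≤ (∏ i ∈ Finset.range j, (R + i)) / (j.factorial : ℝ) := by
  rw [chooseNeg, norm_div, norm_prod, Complex.norm_natCast]
  gcongr with i
  refine (norm_sub_le _ _).trans ?_
  rw [norm_neg, Complex.norm_natCast]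
  gcongr

theorem analyticAt_chooseNeg (j : ℕ) (z : ℂ) : AnalyticAt ℂ (fun s => chooseNeg s j) z := by
  unfold chooseNeg
  refine AnalyticAt.div ?_ analyticAt_const (by exact_mod_cast j.factorial_ne_zero)
  exact Finset.analyticAt_fun_prod _ fun i _ => by fun_prop

/-- Ratio test: consecutive terms have quotient `ρ (R + j) / (j + 1)`, which tends to `ρ < 1`. -/
theorem summable_chooseNeg_bound {R ρ : ℝ} (hR : 0 < R) (hρ : 0 < ρ) (hρ1 : ρ < 1) :
    Summable fun j : ℕ => (∏ i ∈ Finset.range j, (R + i)) / (j.factorial : ℝ) * ρ ^ j := by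
  have hprod (j : ℕ) : 0 < ∏ i ∈ Finset.range j, (R + i) := Finset.prod_pos fun i _ => by positivity
  refine summable_of_ratio_test_tendsto_lt_one hρ1 (Eventually.of_forall fun j => ?_) ?_
  · have := hprod j
    positivity
  · have e (j : ℕ) : ‖(∏ i ∈ Finset.range (j + 1), (R + i)) / ((j + 1).factorial : ℝ) * ρ ^ (j + 1)‖ /
        ‖(∏ i ∈ Finset.range j, (R + i)) / (j.factorial : ℝ) * ρ ^ j‖ =
        ((R - 1) * (1 / ((j : ℝ) + 1)) + 1) * ρ := by
      have h₀ := hprod j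
      have h₁ := hprod (j + 1)
      rw [Real.norm_of_nonneg (by positivity), Real.norm_of_nonneg (by positivity),
        Finset.prod_range_succ, Nat.factorial_succ]
      push_cast
      field_simp
      ring
    simp only [e]
    simpa using ((tendsto_one_div_add_atTop_nhds_zero_nat.const_mul (R - 1)).add_const 1).mul_const ρ

/-! ### Splitting off the last digit, and convergence of the series. -/

section Digits

variable {b : ℕ} {A : Finset ℕ}

/-- The case `a = n = 0` is excluded because `0` has no digits: it is admissible even when the digit
`0` is not allowed. -/
theorem admissible_add_mul (hb : 1 < b) {a n : ℕ} (ha : a < b) (h : a ≠ 0 ∨ n ≠ 0) :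
    Admissible b A (b * n + a) ↔ a ∈ A ∧ Admissible b A n := by
  rw [Admissible, add_comm, Nat.digits_add b hb a n ha h, List.forall_mem_cons, Admissible]

open Classical in
theorem admissibleCoeff_apply (b : ℕ) (A : Finset ℕ) (n : ℕ) :
    admissibleCoeff b A n = if Admissible b A n then 1 else 0 := by
  simp [admissibleCoeff, Set.indicator_apply]

theorem admissibleCoeff_of_digit (hb : 1 < b) {a : ℕ} (ha : a < b) (h : a ≠ 0) :
    admissibleCoeff b A a = if a ∈ A then 1 else 0 := by
  have := admissible_add_mul (A := A) hb ha (n := 0) (Or.inl h)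
  have h0 : Admissible b A 0 := by simp [Admissible]
  simp only [mul_zero, zero_add, h0, and_true] at this
  simp [admissibleCoeff_apply, this]

theorem admissibleCoeff_add_mul (hb : 1 < b) {a n : ℕ} (ha : a < b) (h : n ≠ 0) :
    admissibleCoeff b A (b * n + a) = if a ∈ A then admissibleCoeff b A n else 0 := by
  have := admissible_add_mul (A := A) hb ha (Or.inr h)
  simp only [admissibleCoeff_apply, this]
  split_ifs <;> simp_all

/-- The contribution to `K(s)` of the one-digit integers. -/
noncomputable def digitSum (A : Finset ℕ) (s : ℂ) : ℂ :=
  ∑ a ∈ A with a ≠ 0, (a : ℂ) ^ (-s)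

theorem sum_range_mul {M : Type*} [AddCommMonoid M] (f : ℕ → M) (b X : ℕ) :
    ∑ n ∈ Finset.range (b * X), f n =
      ∑ n ∈ Finset.range X, ∑ a ∈ Finset.range b, f (b * n + a) := by
  induction X with
  | zero => simp
  | succ X ih => rw [mul_add_one, Finset.sum_range_add, ih, Finset.sum_range_succ]

theorem sum_range_eq_sum_digits (hAb : ∀ a ∈ A, a < b) {M : Type*} [AddCommMonoid M] (f : ℕ → M) :
    ∑ a ∈ Finset.range b, (if a ∈ A then f a else 0) = ∑ a ∈ A, f a := by
  rw [← Finset.sum_filter]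
  congr 1
  ext a
  simpa using hAb a

theorem sum_term_block_zero (hb : 1 < b) (hAb : ∀ a ∈ A, a < b) (s : ℂ) :
    ∑ a ∈ Finset.range b, LSeries.term (admissibleCoeff b A) s a = digitSum A s := by
  rw [digitSum, Finset.sum_filter, ← sum_range_eq_sum_digits hAb]
  refine Finset.sum_congr rfl fun a ha => ?_
  rcases eq_or_ne a 0 with rfl | h
  · simp
  · rw [LSeries.term_of_ne_zero h, admissibleCoeff_of_digit hb (Finset.mem_range.1 ha) h]
    split_ifs <;> simp [Complex.cpow_neg]

/-- The complex power of `b * n * (1 + a / (b * n))` splits because the factors are nonnegative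
reals. -/
theorem term_mul_add (hb : 1 < b) {a n : ℕ} (ha : a < b) (hn : n ≠ 0) (s : ℂ) :
    LSeries.term (admissibleCoeff b A) s (b * n + a) =
      if a ∈ A then (b : ℂ) ^ (-s) * LSeries.term (admissibleCoeff b A) s n *
        (1 + (a : ℂ) / (b * n)) ^ (-s) else 0 := by
  rw [LSeries.term_of_ne_zero (by positivity), LSeries.term_of_ne_zero hn,
    admissibleCoeff_add_mul hb ha hn]
  split_ifs
  · have e : ((b * n + a : ℕ) : ℂ) =
        ((b * n : ℝ) : ℂ) * ((1 + (a : ℝ) / (b * n) : ℝ) : ℂ) := by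
      rw [← Complex.ofReal_mul, mul_add, mul_div_cancel₀ _ (by positivity)]
      push_cast
      ring
    rw [div_eq_mul_inv, ← Complex.cpow_neg, e,
      Complex.mul_cpow_ofReal_nonneg (by positivity) (by positivity), Complex.ofReal_mul,
      Complex.ofReal_natCast, Complex.ofReal_natCast, Complex.natCast_mul_natCast_cpow,
      div_eq_mul_inv (admissibleCoeff b A n), ← Complex.cpow_neg]
    push_cast
    ring
  · simp

theorem norm_term_mul_add_le (hb : 1 < b) {a n : ℕ} (ha : a < b) (hn : n ≠ 0) {s : ℂ}
    (hs : 0 ≤ s.re) :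
    ‖LSeries.term (admissibleCoeff b A) s (b * n + a)‖ ≤
      if a ∈ A then (b : ℝ) ^ (-s.re) * ‖LSeries.term (admissibleCoeff b A) s n‖ else 0 := by
  rw [term_mul_add hb ha hn]
  split_ifs
  · have hx : (1 : ℝ) ≤ 1 + (a : ℝ) / (b * n) := by
      have : (0 : ℝ) ≤ (a : ℝ) / (b * n) := by positivity
      linarith
    have e : (1 + (a : ℂ) / (b * n)) = ((1 + (a : ℝ) / (b * n) : ℝ) : ℂ) := by push_cast; ring
    rw [norm_mul, norm_mul, Complex.norm_natCast_cpow_of_pos (by positivity), e,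
      Complex.norm_cpow_eq_rpow_re_of_pos (by positivity), Complex.neg_re]
    exact mul_le_of_le_one_right (by positivity) (Real.rpow_le_one_of_one_le_of_nonpos hx (by simpa))
  · simp

theorem abscissa_nonneg (hb : 1 < b) (hA : A.Nonempty) : 0 ≤ abscissa b A :=
  Real.logb_nonneg (by exact_mod_cast hb) (by exact_mod_cast hA.card_pos)

theorem rpow_abscissa (hb : 1 < b) (hA : A.Nonempty) : (b : ℝ) ^ abscissa b A = A.card :=
  Real.rpow_logb (by positivity) (by exact_mod_cast hb.ne') (by exact_mod_cast hA.card_pos)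

theorem card_mul_rpow_lt_one (hb : 1 < b) (hA : A.Nonempty) {σ : ℝ} (hσ : abscissa b A < σ) :
    A.card * (b : ℝ) ^ (-σ) < 1 := by
  rw [← rpow_abscissa hb hA, ← Real.rpow_add (by positivity)]
  exact Real.rpow_lt_one_of_one_lt_of_neg (by exact_mod_cast hb) (by linarith)

/-- A self-bounding estimate: with `q = N b^(-Re s) < 1`, the partial sums of norms satisfy `S_X ≤
S_{bX} ≤ E + q S_X`, hence `S_X ≤ E / (1 - q)`. -/
theorem lseriesSummable_admissibleCoeff (hb : 1 < b) (hAb : ∀ a ∈ A, a < b) (hA : A.Nonempty)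
    {s : ℂ} (hs : abscissa b A < s.re) : LSeriesSummable (admissibleCoeff b A) s := by
  set q : ℝ := A.card * (b : ℝ) ^ (-s.re) with hq
  have hq1 : q < 1 := card_mul_rpow_lt_one hb hA hs
  have hs0 : 0 ≤ s.re := (abscissa_nonneg hb hA).trans hs.le
  set t : ℕ → ℝ := fun n => ‖LSeries.term (admissibleCoeff b A) s n‖ with ht
  set E : ℝ := ∑ a ∈ Finset.range b, t a with hE
  have hE0 : 0 ≤ E := Finset.sum_nonneg fun _ _ => norm_nonneg _
  have hblock (n : ℕ) :
      ∑ a ∈ Finset.range b, t (b * n + a) ≤ (if n = 0 then E else 0) + q * t n := by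
    rcases eq_or_ne n 0 with rfl | hn
    · simp [hE, ht]
    · refine (Finset.sum_le_sum fun a ha =>
        norm_term_mul_add_le hb (Finset.mem_range.1 ha) hn hs0).trans ?_
      rw [sum_range_eq_sum_digits hAb, Finset.sum_const, nsmul_eq_mul, if_neg hn, zero_add, hq,
        mul_assoc]
  refine Summable.of_norm (summable_of_sum_range_le (c := E / (1 - q)) (fun _ => norm_nonneg _)
    fun X => ?_)
  change ∑ n ∈ Finset.range X, t n ≤ _
  have h₁ : ∑ n ∈ Finset.range X, t n ≤ ∑ n ∈ Finset.range (b * X), t n :=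
    Finset.sum_le_sum_of_subset_of_nonneg
      (Finset.range_subset_range.2 (Nat.le_mul_of_pos_left X (by positivity)))
      fun _ _ _ => norm_nonneg _
  have h₂ : ∑ n ∈ Finset.range (b * X), t n ≤ E + q * ∑ n ∈ Finset.range X, t n := by
    rw [sum_range_mul, Finset.mul_sum]
    refine (Finset.sum_le_sum fun n _ => hblock n).trans ?_
    rw [Finset.sum_add_distrib, Finset.sum_ite_eq']
    gcongr
    split_ifs
    exacts [le_rfl, hE0]
  rw [le_div_iff₀ (by linarith)]
  linarith

/-- The partial sums of the blocks form the subsequence of the partial sums of `f` taken at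
multiples of `b`. -/
theorem hasSum_sum_block (hb : 1 < b) {f : ℕ → ℂ} (hf : Summable f) :
    HasSum (fun n => ∑ a ∈ Finset.range b, f (b * n + a)) (∑' n, f n) := by
  have hs : Summable fun n => ∑ a ∈ Finset.range b, f (b * n + a) := by
    refine summable_sum fun a _ => hf.comp_injective (i := fun n => b * n + a) fun m n h => ?_
    exact Nat.eq_of_mul_eq_mul_left (by positivity) (Nat.add_right_cancel h)
  have h₁ := hs.hasSum.tendsto_sum_nat
  have h₂ := hf.hasSum.tendsto_sum_nat.comp
    (tendsto_id.const_mul_atTop' (show 0 < b by positivity))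
  have h₃ : (fun X => ∑ n ∈ Finset.range X, ∑ a ∈ Finset.range b, f (b * n + a)) =
      (fun X => ∑ n ∈ Finset.range X, f n) ∘ fun X => b * id X := by
    ext X
    exact (sum_range_mul f b X).symm
  rw [← h₃] at h₂
  rw [← tendsto_nhds_unique h₁ h₂]
  exact hs.hasSum

end Digits

/-! ### The functional equation in the half-plane of convergence. -/

section FunctionalEquation

variable {b : ℕ} {A : Finset ℕ}

/-- The coefficient of `K(s + j)` in the functional equation of `K`. -/
noncomputable def shiftCoeff (b : ℕ) (A : Finset ℕ) (s : ℂ) (j : ℕ) : ℂ :=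
  chooseNeg s j * (digitPowerSum A j / (b : ℂ) ^ j)

@[simp] theorem shiftCoeff_zero (s : ℂ) : shiftCoeff b A s 0 = A.card := by
  simp [shiftCoeff, digitPowerSum]

theorem analyticAt_shiftCoeff (j : ℕ) (z : ℂ) : AnalyticAt ℂ (fun s => shiftCoeff b A s j) z :=
  (analyticAt_chooseNeg j z).mul analyticAt_const

/-- Digits are at most `b - 1`, so the decay is geometric with ratio below `1`; this is what makes
the sum over `j` converge. -/
theorem norm_digitPowerSum_div_le (hb : 1 < b) (hAb : ∀ a ∈ A, a < b) (j : ℕ) :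
    ‖digitPowerSum A j / (b : ℂ) ^ j‖ ≤ A.card * (((b : ℝ) - 1) / b) ^ j := by
  rw [digitPowerSum, Finset.sum_div, ← nsmul_eq_mul, ← Finset.sum_const]
  refine norm_sum_le_of_le _ fun a ha => ?_
  rw [← div_pow, norm_pow, norm_div, Complex.norm_natCast, Complex.norm_natCast]
  have : (a : ℝ) + 1 ≤ b := by exact_mod_cast hAb a ha
  gcongr
  linarith

/-- A summable bound for the coefficients `shiftCoeff b A s j` on the disc `‖s‖ ≤ R`. -/
noncomputable def shiftBound (b : ℕ) (A : Finset ℕ) (R : ℝ) (j : ℕ) : ℝ :=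
  (∏ i ∈ Finset.range j, (R + i)) / (j.factorial : ℝ) * (A.card * (((b : ℝ) - 1) / b) ^ j)

theorem norm_shiftCoeff_le (hb : 1 < b) (hAb : ∀ a ∈ A, a < b) {s : ℂ} {R : ℝ} (hs : ‖s‖ ≤ R)
    (j : ℕ) : ‖shiftCoeff b A s j‖ ≤ shiftBound b A R j := by
  have hR : 0 ≤ R := (norm_nonneg s).trans hs
  rw [shiftCoeff, norm_mul, shiftBound]
  exact mul_le_mul (norm_chooseNeg_le hs j) (norm_digitPowerSum_div_le hb hAb j) (norm_nonneg _)
    (by positivity)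

theorem summable_shiftBound (hb : 1 < b) (A : Finset ℕ) {R : ℝ} (hR : 0 < R) :
    Summable (shiftBound b A R) := by
  have hb' : (1 : ℝ) < b := by exact_mod_cast hb
  have h := (summable_chooseNeg_bound hR (ρ := ((b : ℝ) - 1) / b)
    (div_pos (by linarith) (by linarith)) ((div_lt_one (by linarith)).2 (by linarith))).mul_left
    (A.card : ℝ)
  refine h.congr fun j => ?_
  rw [shiftBound]
  ring

theorem term_add_natCast (f : ℕ → ℂ) (s : ℂ) (j n : ℕ) :
    LSeries.term f (s + j) n = LSeries.term f s n * (1 / (n : ℂ)) ^ j := by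
  rcases eq_or_ne n 0 with rfl | hn
  · simp
  · have : (n : ℂ) ≠ 0 := by exact_mod_cast hn
    rw [LSeries.term_of_ne_zero hn, LSeries.term_of_ne_zero hn, Complex.cpow_add _ _ this,
      Complex.cpow_natCast, one_div, inv_pow]
    field_simp

theorem hasSum_shiftCoeff_mul_term (hAb : ∀ a ∈ A, a < b) (s : ℂ) {n : ℕ}
    (hn : n ≠ 0) :
    HasSum (fun j => shiftCoeff b A s j * LSeries.term (admissibleCoeff b A) (s + j) n)
      (∑ a ∈ A, LSeries.term (admissibleCoeff b A) s n * (1 + (a : ℂ) / (b * n)) ^ (-s)) := by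
  have h : ∀ a ∈ A, HasSum (fun j => LSeries.term (admissibleCoeff b A) s n *
      (chooseNeg s j * ((a : ℂ) / (b * n)) ^ j))
      (LSeries.term (admissibleCoeff b A) s n * (1 + (a : ℂ) / (b * n)) ^ (-s)) := fun a ha => by
    refine (hasSum_chooseNeg_mul_pow s ?_).mul_left _
    have h₁ : a < b * n := (hAb a ha).trans_le (Nat.le_mul_of_pos_right b (by positivity))
    have h₂ : (0 : ℝ) < (b : ℝ) * n := by exact_mod_cast (Nat.zero_le a).trans_lt h₁
    rw [norm_div, norm_mul, Complex.norm_natCast, Complex.norm_natCast, Complex.norm_natCast,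
      div_lt_one h₂]
    exact_mod_cast h₁
  convert hasSum_sum h using 2 with j
  rw [term_add_natCast, shiftCoeff, digitPowerSum, Finset.sum_div, Finset.mul_sum, Finset.sum_mul]
  refine Finset.sum_congr rfl fun a _ => ?_
  simp only [div_pow, mul_pow, one_pow]
  ring

theorem norm_LSeries_le {f : ℕ → ℂ} {s s' : ℂ} (hs : LSeriesSummable f s) (h : s.re ≤ s'.re) :
    ‖LSeries f s'‖ ≤ ∑' n, ‖LSeries.term f s n‖ :=
  tsum_of_norm_bounded hs.norm.hasSum (LSeries.norm_term_le_of_re_le_re f h)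

theorem summable_shiftCoeff_mul (hb : 1 < b) (hAb : ∀ a ∈ A, a < b) (hA : A.Nonempty) {s : ℂ}
    {k : ℕ} (hs : abscissa b A < s.re + k) :
    Summable fun j : ℕ =>
      shiftCoeff b A s (j + k) * LSeries (admissibleCoeff b A) (s + (j + k : ℕ)) := by
  have hL : LSeriesSummable (admissibleCoeff b A) (s + k) :=
    lseriesSummable_admissibleCoeff hb hAb hA (by simpa using hs)
  have hR : 0 < ‖s‖ + 1 := by positivity
  refine Summable.of_norm_bounded (((summable_nat_add_iff k).2 (summable_shiftBound hb A hR)).mul_right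
    (∑' n, ‖LSeries.term (admissibleCoeff b A) (s + k) n‖)) fun j => ?_
  rw [norm_mul]
  have h₁ := norm_shiftCoeff_le hb hAb (show ‖s‖ ≤ ‖s‖ + 1 by linarith) (j + k)
  exact mul_le_mul h₁ (norm_LSeries_le hL (by simp)) (norm_nonneg _) ((norm_nonneg _).trans h₁)

theorem analyticAt_lseries_admissibleCoeff (hb : 1 < b) (hAb : ∀ a ∈ A, a < b) (hA : A.Nonempty)
    {s : ℂ} (hs : abscissa b A < s.re) : AnalyticAt ℂ (LSeries (admissibleCoeff b A)) s := by
  refine LSeries_analyticOnNhd _ s ?_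
  have : LSeries.abscissaOfAbsConv (admissibleCoeff b A) ≤ abscissa b A :=
    LSeries.abscissaOfAbsConv_le_of_forall_lt_LSeriesSummable fun y hy =>
      lseriesSummable_admissibleCoeff hb hAb hA (by simpa using hy)
  exact this.trans_lt (by exact_mod_cast hs)

/-- Weierstrass' theorem on the intersection of a disc, where the coefficients have a summable
bound, with a half-plane `Re s + k > σ > s₀`, where all the shifted series are bounded by the sum of
norms at `σ`. -/
theorem analyticAt_tsum_shiftCoeff_mul (hb : 1 < b) (hAb : ∀ a ∈ A, a < b) (hA : A.Nonempty)
    {z : ℂ} {k : ℕ} (hz : abscissa b A < z.re + k) :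
    AnalyticAt ℂ (fun s => ∑' j : ℕ,
      shiftCoeff b A s (j + k) * LSeries (admissibleCoeff b A) (s + (j + k : ℕ))) z := by
  obtain ⟨σ, hσ, hσz⟩ := exists_between hz
  have hL : LSeriesSummable (admissibleCoeff b A) σ :=
    lseriesSummable_admissibleCoeff hb hAb hA (by simpa using hσ)
  have hR : 0 < ‖z‖ + 1 := by positivity
  set U : Set ℂ := {s | ‖s‖ < ‖z‖ + 1} ∩ {s | σ < s.re + k}
  have hU : IsOpen U := (isOpen_lt continuous_norm continuous_const).inter
    (isOpen_lt continuous_const (Complex.continuous_re.add continuous_const))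
  have hzU : z ∈ U := ⟨lt_add_one ‖z‖, hσz⟩
  refine DifferentiableOn.analyticAt (s := U) ?_ (hU.mem_nhds hzU)
  refine Complex.differentiableOn_tsum_of_summable_norm
    (((summable_nat_add_iff k).2 (summable_shiftBound hb A hR)).mul_right
      (∑' n, ‖LSeries.term (admissibleCoeff b A) σ n‖)) (fun j s hs => ?_) hU fun j s hs => ?_
  · refine (AnalyticAt.differentiableAt ?_).differentiableWithinAt
    refine (analyticAt_shiftCoeff _ _).mul (AnalyticAt.fun_comp
      (g := LSeries (admissibleCoeff b A)) (f := fun w : ℂ => w + (j + k : ℕ)) ?_ (by fun_prop))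
    refine analyticAt_lseries_admissibleCoeff hb hAb hA ?_
    have h₂ : σ < s.re + k := hs.2
    simp
    linarith [(Nat.cast_nonneg j : (0 : ℝ) ≤ j)]
  · rw [norm_mul]
    have h₁ := norm_shiftCoeff_le hb hAb (le_of_lt hs.1) (j + k)
    refine mul_le_mul h₁ (norm_LSeries_le hL ?_) (norm_nonneg _) ((norm_nonneg _).trans h₁)
    have h₂ : σ < s.re + k := hs.2
    simp
    linarith [(Nat.cast_nonneg j : (0 : ℝ) ≤ j)]

theorem lseries_eq_digitSum_add (hb : 1 < b) (hAb : ∀ a ∈ A, a < b) (hA : A.Nonempty) {s : ℂ}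
    (hs : abscissa b A < s.re) :
    LSeries (admissibleCoeff b A) s = digitSum A s + (b : ℂ) ^ (-s) *
      ∑' j : ℕ, shiftCoeff b A s j * LSeries (admissibleCoeff b A) (s + j) := by
  set f := admissibleCoeff b A with hf
  have hL : LSeriesSummable f s := lseriesSummable_admissibleCoeff hb hAb hA hs
  have hR : 0 < ‖s‖ + 1 := by positivity
  -- Shifting `s` to `s + j` does not increase the norm of a term, so the double series is dominated
  -- by a product of two summable series; this permits exchanging the sums over `n` and `j`.
  have hdouble : Summable (Function.uncurry fun n j : ℕ =>
      shiftCoeff b A s j * LSeries.term f (s + j) n) := by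
    refine Summable.of_norm_bounded (hL.norm.mul_of_nonneg (summable_shiftBound hb A hR)
      (fun _ => norm_nonneg _) fun j =>
        (norm_nonneg _).trans (norm_shiftCoeff_le hb hAb (show ‖s‖ ≤ ‖s‖ + 1 by linarith) j)) ?_
    rintro ⟨n, j⟩
    simp only [Function.uncurry_apply_pair, norm_mul]
    rw [mul_comm]
    exact mul_le_mul (LSeries.norm_term_le_of_re_le_re f (by simp) n)
      (norm_shiftCoeff_le hb hAb (by linarith) j) (norm_nonneg _) (norm_nonneg _)
  -- The block `n = 0` consists of the one-digit integers; there the sum over `j` vanishes, as the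
  -- term of index `0` is zero.
  have hblock (n : ℕ) : ∑ a ∈ Finset.range b, LSeries.term f s (b * n + a) =
      (if n = 0 then digitSum A s else 0) +
        (b : ℂ) ^ (-s) * ∑' j : ℕ, shiftCoeff b A s j * LSeries.term f (s + j) n := by
    rcases eq_or_ne n 0 with rfl | hn
    · simp [hf, sum_term_block_zero hb hAb]
    · rw [(hasSum_shiftCoeff_mul_term hAb s hn).tsum_eq, if_neg hn, zero_add, Finset.mul_sum,
        ← sum_range_eq_sum_digits hAb]
      refine Finset.sum_congr rfl fun a ha => ?_
      rw [hf, term_mul_add hb (Finset.mem_range.1 ha) hn]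
      split_ifs
      · ring
      · rfl
  have hsum := (hasSum_sum_block hb hL).tsum_eq
  simp only [hblock] at hsum
  have hinner : Summable fun n => ∑' j : ℕ, shiftCoeff b A s j * LSeries.term f (s + j) n :=
    hdouble.prod
  rw [Summable.tsum_add (summable_of_ne_finset_zero (s := {0}) fun n hn => by simp_all)
    (hinner.mul_left _), tsum_ite_eq, tsum_mul_left, ← hdouble.tsum_comm] at hsum
  simp only [tsum_mul_left] at hsum
  exact hsum.symm

end FunctionalEquation

/-! ### Meromorphic continuation strip by strip. -/

section Continuation

variable {b : ℕ} {A : Finset ℕ}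

/-- Continuations of the restricted Dirichlet series obtained by solving the functional equation
for `K(s)` repeatedly; the `J`-th one is valid for `Re s > s₀ - J`. -/
noncomputable def iteratedContinuation (b : ℕ) (A : Finset ℕ) : ℕ → ℂ → ℂ
  | 0 => LSeries (admissibleCoeff b A)
  | J + 1 => fun s => (1 - A.card * (b : ℂ) ^ (-s))⁻¹ * (digitSum A s + (b : ℂ) ^ (-s) *
      ∑' j : ℕ, shiftCoeff b A s (j + 1) * iteratedContinuation b A J (s + (j + 1 : ℕ)))

theorem iteratedContinuation_succ_apply (b : ℕ) (A : Finset ℕ) (J : ℕ) (s : ℂ) :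
    iteratedContinuation b A (J + 1) s =
      (1 - A.card * (b : ℂ) ^ (-s))⁻¹ * (digitSum A s + (b : ℂ) ^ (-s) *
        ∑' j : ℕ, shiftCoeff b A s (j + 1) * iteratedContinuation b A J (s + (j + 1 : ℕ))) :=
  rfl

/-- The meromorphic continuation of the restricted Dirichlet series. -/
noncomputable def restrictedDirichlet (b : ℕ) (A : Finset ℕ) (s : ℂ) : ℂ :=
  iteratedContinuation b A (⌊abscissa b A - s.re⌋₊ + 1) s

theorem one_sub_card_mul_cpow_ne_zero (hb : 1 < b) (hA : A.Nonempty) {s : ℂ}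
    (hs : abscissa b A < s.re) : 1 - A.card * (b : ℂ) ^ (-s) ≠ 0 := by
  intro h
  have h₁ : ‖(A.card : ℂ) * (b : ℂ) ^ (-s)‖ = 1 := by rw [← sub_eq_zero.1 h, norm_one]
  rw [norm_mul, Complex.norm_natCast, Complex.norm_natCast_cpow_of_pos (by positivity),
    Complex.neg_re] at h₁
  exact (card_mul_rpow_lt_one hb hA hs).ne h₁

/-- For `J = 0` this is the functional equation solved for its `j = 0` term. Afterwards the
recursion only evaluates at points moved right by at least `1`, which pays for the larger domain. -/
theorem iteratedContinuation_succ (hb : 1 < b) (hAb : ∀ a ∈ A, a < b) (hA : A.Nonempty) (J : ℕ)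
    {s : ℂ} (hs : abscissa b A < s.re + J) :
    iteratedContinuation b A (J + 1) s = iteratedContinuation b A J s := by
  induction J generalizing s with
  | zero =>
    have hs' : abscissa b A < s.re := by simpa using hs
    simp only [iteratedContinuation]
    rw [inv_mul_eq_iff_eq_mul₀ (one_sub_card_mul_cpow_ne_zero hb hA hs')]
    have h := lseries_eq_digitSum_add hb hAb hA hs'
    rw [Summable.tsum_eq_zero_add (by simpa using summable_shiftCoeff_mul hb hAb hA (k := 0) hs),
      shiftCoeff_zero, Nat.cast_zero, add_zero] at h
    linear_combination -h
  | succ J ih =>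
    rw [iteratedContinuation_succ_apply, iteratedContinuation_succ_apply b A J s]
    congr 3
    refine tsum_congr fun j => ?_
    rw [ih]
    push_cast at hs
    simp
    linarith [(Nat.cast_nonneg j : (0 : ℝ) ≤ j)]

theorem iteratedContinuation_eq_of_le (hb : 1 < b) (hAb : ∀ a ∈ A, a < b) (hA : A.Nonempty)
    {J J' : ℕ} (h : J ≤ J') {s : ℂ} (hs : abscissa b A < s.re + J) :
    iteratedContinuation b A J' s = iteratedContinuation b A J s := by
  induction J', h using Nat.le_induction with
  | base => rfl
  | succ J' h ih =>
    rw [iteratedContinuation_succ hb hAb hA, ih]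
    have : (J : ℝ) ≤ J' := by exact_mod_cast h
    linarith

theorem restrictedDirichlet_eq (hb : 1 < b) (hAb : ∀ a ∈ A, a < b) (hA : A.Nonempty)
    {J : ℕ} {s : ℂ} (hs : abscissa b A < s.re + J) :
    restrictedDirichlet b A s = iteratedContinuation b A J s := by
  -- `x < ⌊x⌋₊ + 1` holds for negative `x` too, where the natural floor is `0`.
  have h : abscissa b A < s.re + (⌊abscissa b A - s.re⌋₊ + 1 : ℕ) := by
    have := Nat.lt_floor_add_one (abscissa b A - s.re)
    push_cast
    linarith
  rw [restrictedDirichlet]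
  rcases le_total J (⌊abscissa b A - s.re⌋₊ + 1) with hJ | hJ
  · exact iteratedContinuation_eq_of_le hb hAb hA hJ hs
  · exact (iteratedContinuation_eq_of_le hb hAb hA hJ h).symm

theorem restrictedDirichlet_eq_lseries (hb : 1 < b) (hAb : ∀ a ∈ A, a < b) (hA : A.Nonempty)
    {s : ℂ} (hs : abscissa b A < s.re) :
    restrictedDirichlet b A s = LSeries (admissibleCoeff b A) s :=
  restrictedDirichlet_eq hb hAb hA (J := 0) (by simpa using hs)

/-- For shifts beyond `m` the point lies in the half-plane of convergence, so the tail is written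
with the series itself and is analytic. Only finitely many shifted continuations remain to carry
singularities. -/
theorem restrictedDirichlet_functional_equation (hb : 1 < b) (hAb : ∀ a ∈ A, a < b)
    (hA : A.Nonempty) {m : ℕ} {s : ℂ} (hs : abscissa b A < s.re + (m + 1 : ℕ)) :
    restrictedDirichlet b A s = (1 - A.card * (b : ℂ) ^ (-s))⁻¹ * (digitSum A s + (b : ℂ) ^ (-s) *
      (∑ j ∈ Finset.range m,
        shiftCoeff b A s (j + 1) * restrictedDirichlet b A (s + (j + 1 : ℕ)) +
      ∑' j : ℕ, shiftCoeff b A s (j + (m + 1)) *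
        LSeries (admissibleCoeff b A) (s + (j + (m + 1) : ℕ)))) := by
  have hj (j : ℕ) : (0 : ℝ) ≤ j := Nat.cast_nonneg j
  have htail (j : ℕ) : shiftCoeff b A s (j + (m + 1)) *
      LSeries (admissibleCoeff b A) (s + (j + (m + 1) : ℕ)) =
      shiftCoeff b A s (j + m + 1) * restrictedDirichlet b A (s + (j + m + 1 : ℕ)) := by
    rw [add_assoc j m 1, restrictedDirichlet_eq_lseries hb hAb hA]
    push_cast at hs
    simp
    linarith [hj j]
  have hsum := summable_shiftCoeff_mul hb hAb hA hs
  simp only [htail] at hsum ⊢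
  rw [restrictedDirichlet_eq hb hAb hA hs, iteratedContinuation_succ_apply,
    Summable.sum_add_tsum_nat_add (f := fun j => shiftCoeff b A s (j + 1) *
      restrictedDirichlet b A (s + (j + 1 : ℕ))) m ((summable_nat_add_iff m).1 hsum)]
  congr 3
  refine tsum_congr fun j => ?_
  rw [restrictedDirichlet_eq hb hAb hA (J := m)]
  push_cast at hs
  simp
  linarith [hj j]

theorem analyticAt_natCast_cpow_neg {n : ℕ} (hn : n ≠ 0) (z : ℂ) :
    AnalyticAt ℂ (fun s : ℂ => (n : ℂ) ^ (-s)) z := by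
  refine Differentiable.analyticAt (fun s => ?_) z
  exact differentiableAt_id.neg.const_cpow (Or.inl (by exact_mod_cast hn))

theorem analyticAt_digitSum (A : Finset ℕ) (z : ℂ) : AnalyticAt ℂ (digitSum A) z := by
  unfold digitSum
  exact Finset.analyticAt_fun_sum _ fun a ha =>
    analyticAt_natCast_cpow_neg (Finset.mem_filter.1 ha).2 z

theorem restrictedDirichlet_eventuallyEq (hb : 1 < b) (hAb : ∀ a ∈ A, a < b)
    (hA : A.Nonempty) {m : ℕ} {z : ℂ} (hz : abscissa b A < z.re + (m + 1 : ℕ)) :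
    restrictedDirichlet b A =ᶠ[𝓝 z] fun s =>
      (1 - A.card * (b : ℂ) ^ (-s))⁻¹ * (digitSum A s + (b : ℂ) ^ (-s) *
        (∑ j ∈ Finset.range m,
          shiftCoeff b A s (j + 1) * restrictedDirichlet b A (s + (j + 1 : ℕ)) +
        ∑' j : ℕ, shiftCoeff b A s (j + (m + 1)) *
          LSeries (admissibleCoeff b A) (s + (j + (m + 1) : ℕ)))) := by
  have hU : IsOpen {s : ℂ | abscissa b A < s.re + (m + 1 : ℕ)} :=
    isOpen_lt continuous_const (Complex.continuous_re.add continuous_const)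
  filter_upwards [hU.mem_nhds hz] with s hs
  exact restrictedDirichlet_functional_equation hb hAb hA hs

theorem meromorphicAt_comp_add_const {f : ℂ → ℂ} {z d : ℂ} (h : MeromorphicAt f (z + d)) :
    MeromorphicAt (fun s => f (s + d)) z :=
  h.comp_analyticAt (g := fun s => s + d) (by fun_prop)

theorem meromorphicAt_restrictedDirichlet (hb : 1 < b) (hAb : ∀ a ∈ A, a < b)
    (hA : A.Nonempty) (z : ℂ) : MeromorphicAt (restrictedDirichlet b A) z := by
  obtain ⟨m, hm⟩ : ∃ m : ℕ, abscissa b A < z.re + (m + 1 : ℕ) := by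
    obtain ⟨m, hm⟩ := exists_nat_gt (abscissa b A - z.re)
    exact ⟨m, by push_cast; linarith⟩
  -- The shift by `j + 1` reduces the number of strips to cross by `j + 1`, so all smaller values
  -- are needed.
  induction m using Nat.strong_induction_on generalizing z with
  | _ m ih =>
    refine MeromorphicAt.congr ?_ (((restrictedDirichlet_eventuallyEq hb hAb hA hm).filter_mono
      nhdsWithin_le_nhds).symm)
    have hp := analyticAt_natCast_cpow_neg (show b ≠ 0 by positivity) z
    refine (analyticAt_const.sub (analyticAt_const.mul hp)).meromorphicAt.inv.mul
      ((analyticAt_digitSum A z).meromorphicAt.add (hp.meromorphicAt.mul (MeromorphicAt.add ?_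
        (analyticAt_tsum_shiftCoeff_mul hb hAb hA hm).meromorphicAt)))
    refine MeromorphicAt.fun_sum fun j hj => ?_
    have hj := Finset.mem_range.1 hj
    refine (analyticAt_shiftCoeff _ _).meromorphicAt.mul (meromorphicAt_comp_add_const
      (ih (m - (j + 1)) (by omega) _ ?_))
    have e : ((m - (j + 1) : ℕ) : ℝ) = m - (j + 1) := by
      rw [Nat.cast_sub (Nat.succ_le_of_lt hj), Nat.cast_succ]
    push_cast at hm ⊢
    simp [e]
    linarith

theorem isRestrictedDirichlet_restrictedDirichlet (hb : 1 < b) (hAb : ∀ a ∈ A, a < b)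
    (hA : A.Nonempty) : IsRestrictedDirichlet b A (restrictedDirichlet b A) where
  meromorphic z _ := meromorphicAt_restrictedDirichlet hb hAb hA z
  hasSum s hs := by
    rw [restrictedDirichlet_eq_lseries hb hAb hA hs]
    exact (lseriesSummable_admissibleCoeff hb hAb hA hs).LSeriesHasSum

end Continuation

/-! ### Poles and residues at the lattice points. -/

section Residues

variable {b : ℕ} {A : Finset ℕ}

/-- `b ^ s₀ = N`, and `2πik / log b` is a period of `b ^ s`. -/
theorem natCast_cpow_neg_latticePoint (hb : 1 < b) (hA : A.Nonempty) (m : ℕ) (k : ℤ) :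
    (b : ℂ) ^ (-latticePoint b A m k) = (b : ℂ) ^ m / A.card := by
  have hb0 : (b : ℂ) ≠ 0 := by exact_mod_cast (by positivity : b ≠ 0)
  have hlog : (Real.log b : ℂ) ≠ 0 := by
    exact_mod_cast (Real.log_pos (by exact_mod_cast hb)).ne'
  have h₁ : (b : ℂ) ^ (abscissa b A : ℂ) = A.card := by
    rw [← Complex.ofReal_natCast, ← Complex.ofReal_cpow (by positivity), rpow_abscissa hb hA,
      Complex.ofReal_natCast]
  have h₂ : (b : ℂ) ^ (k * (2 * Real.pi * Complex.I / Real.log b)) = 1 := by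
    rw [Complex.cpow_def_of_ne_zero hb0, ← Complex.natCast_log, mul_left_comm,
      mul_div_cancel₀ _ hlog, Complex.exp_int_mul_two_pi_mul_I]
  rw [Complex.cpow_neg, latticePoint, Complex.cpow_add _ _ hb0, Complex.cpow_sub _ _ hb0, h₁, h₂,
    Complex.cpow_natCast, mul_one, inv_div]

theorem latticePoint_re (b : ℕ) (A : Finset ℕ) (m : ℕ) (k : ℤ) :
    (latticePoint b A m k).re = abscissa b A - m := by
  have : (k * (2 * Real.pi * Complex.I / Real.log b) : ℂ) =
      ((k * (2 * Real.pi / Real.log b) : ℝ) : ℂ) * Complex.I := by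
    push_cast
    ring
  rw [latticePoint, this, Complex.add_re, Complex.re_ofReal_mul, Complex.I_re, mul_zero]
  simp

theorem latticePoint_add_natCast (b : ℕ) (A : Finset ℕ) {m j : ℕ} (h : j ≤ m) (k : ℤ) :
    latticePoint b A m k + j = latticePoint b A (m - j) k := by
  rw [latticePoint, latticePoint, Nat.cast_sub h]
  ring

theorem one_sub_card_mul_cpow_latticePoint (hb : 1 < b) (hA : A.Nonempty) (m : ℕ) (k : ℤ) :
    1 - A.card * (b : ℂ) ^ (-latticePoint b A m k) = 1 - (b : ℂ) ^ m := by
  have : (A.card : ℂ) ≠ 0 := by exact_mod_cast hA.card_pos.ne'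
  rw [natCast_cpow_neg_latticePoint hb hA, mul_div_cancel₀ _ this]

theorem one_sub_pow_ne_zero (hb : 1 < b) {m : ℕ} (hm : m ≠ 0) : 1 - (b : ℂ) ^ m ≠ 0 := by
  rw [sub_ne_zero]
  exact_mod_cast (Nat.one_lt_pow hm hb).ne

theorem analyticAt_one_sub_card_mul_cpow (hb : 1 < b) (A : Finset ℕ) (z : ℂ) :
    AnalyticAt ℂ (fun s : ℂ => 1 - A.card * (b : ℂ) ^ (-s)) z :=
  analyticAt_const.sub (analyticAt_const.mul (analyticAt_natCast_cpow_neg (by positivity) z))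

/-- The derivative of `1 - N b^(-s)` at this point is `log b ≠ 0`. In the functional equation with
`m = 0` the finite sum is empty, so the other factor is analytic. -/
theorem exists_hasSimplePoleAt_latticePoint_zero (hb : 1 < b) (hAb : ∀ a ∈ A, a < b)
    (hA : A.Nonempty) (k : ℤ) :
    ∃ c, HasSimplePoleAt (restrictedDirichlet b A) (latticePoint b A 0 k) c := by
  set z := latticePoint b A 0 k with hz
  have hb0 : b ≠ 0 := by positivity
  have hN : (A.card : ℂ) ≠ 0 := by exact_mod_cast hA.card_pos.ne'
  have hre : abscissa b A < z.re + (0 + 1 : ℕ) := by rw [hz, latticePoint_re]; simp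
  have hd : HasDerivAt (fun s : ℂ => 1 - A.card * (b : ℂ) ^ (-s)) (Complex.log b) z := by
    have h := (((hasDerivAt_id z).neg.const_cpow (c := (b : ℂ))
      (Or.inl (by exact_mod_cast hb0))).const_mul (A.card : ℂ)).const_sub 1
    refine h.congr_deriv ?_
    have := natCast_cpow_neg_latticePoint hb hA 0 k
    simp only [Pi.neg_apply, id_eq, ← hz] at this ⊢
    rw [this]
    field_simp
  have h := HasSimplePoleAt.inv_mul_of_simple_zero
    (analyticAt_one_sub_card_mul_cpow hb A z)
    (by rw [hz, one_sub_card_mul_cpow_latticePoint hb hA]; simp)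
    (by
      rw [hd.deriv, ← Complex.natCast_log]
      exact_mod_cast (Real.log_pos (by exact_mod_cast hb)).ne')
    ((analyticAt_digitSum A z).add ((analyticAt_natCast_cpow_neg hb0 z).mul
      (analyticAt_tsum_shiftCoeff_mul hb hAb hA hre)))
  refine ⟨_, h.congr (((restrictedDirichlet_eventuallyEq hb hAb hA hre).filter_mono
    nhdsWithin_le_nhds).trans (Eventually.of_forall fun s => ?_))⟩
  simp

/-- The prefactor is analytic here because `1 - b^m ≠ 0`; the digit sum and the tail contribute
residue `0`, and the shift by `j + 1` leads to the lattice point of index `m - (j + 1)`. -/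
theorem hasSimplePoleAt_latticePoint_of_lt (hb : 1 < b) (hAb : ∀ a ∈ A, a < b)
    (hA : A.Nonempty) {m : ℕ} (hm : m ≠ 0) (k : ℤ) {c : ℕ → ℂ}
    (hc : ∀ i < m, HasSimplePoleAt (restrictedDirichlet b A) (latticePoint b A i k) (c i)) :
    HasSimplePoleAt (restrictedDirichlet b A) (latticePoint b A m k)
      ((1 - (b : ℂ) ^ m)⁻¹ * ((b : ℂ) ^ m / A.card * ∑ j ∈ Finset.range m,
        shiftCoeff b A (latticePoint b A m k) (j + 1) * c (m - (j + 1)))) := by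
  set z := latticePoint b A m k with hz
  have hre : abscissa b A < z.re + (m + 1 : ℕ) := by rw [hz, latticePoint_re]; push_cast; linarith
  have hD := one_sub_card_mul_cpow_latticePoint hb hA m k
  have hp := analyticAt_natCast_cpow_neg (show b ≠ 0 by positivity) z
  have hsum : HasSimplePoleAt (fun s => ∑ j ∈ Finset.range m,
      shiftCoeff b A s (j + 1) * restrictedDirichlet b A (s + (j + 1 : ℕ))) z
      (∑ j ∈ Finset.range m, shiftCoeff b A z (j + 1) * c (m - (j + 1))) := by
    refine HasSimplePoleAt.sum _ fun j hj => ?_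
    have hj := Finset.mem_range.1 hj
    refine HasSimplePoleAt.analyticAt_mul (HasSimplePoleAt.comp_add_const ?_)
      (analyticAt_shiftCoeff _ _)
    rw [hz, latticePoint_add_natCast b A hj]
    exact hc _ (by omega)
  have h := (((hsum.add (.of_analyticAt (analyticAt_tsum_shiftCoeff_mul hb hAb hA hre))).analyticAt_mul
    hp).add (.of_analyticAt (analyticAt_digitSum A z))).analyticAt_mul
    ((analyticAt_one_sub_card_mul_cpow hb A z).inv (by
      rw [hz, hD]
      exact one_sub_pow_ne_zero hb hm))
  simp only [Pi.inv_apply, add_zero] at h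
  rw [hz, hD, natCast_cpow_neg_latticePoint hb hA] at h
  refine h.congr (((restrictedDirichlet_eventuallyEq hb hAb hA hre).filter_mono
    nhdsWithin_le_nhds).trans (Eventually.of_forall fun s => ?_))
  ring

theorem hasSimplePoleAt_latticePoint (hb : 1 < b) (hAb : ∀ a ∈ A, a < b)
    (hA : A.Nonempty) (m : ℕ) (k : ℤ) :
    HasSimplePoleAt (restrictedDirichlet b A) (latticePoint b A m k)
      (complexResidue (restrictedDirichlet b A) (latticePoint b A m k)) := by
  suffices ∃ c, HasSimplePoleAt (restrictedDirichlet b A) (latticePoint b A m k) c by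
    obtain ⟨c, hc⟩ := this
    rwa [hc.complexResidue_eq]
  induction m using Nat.strong_induction_on with
  | _ m ih =>
    rcases eq_or_ne m 0 with rfl | hm
    · exact exists_hasSimplePoleAt_latticePoint_zero hb hAb hA k
    · refine ⟨_, hasSimplePoleAt_latticePoint_of_lt hb hAb hA hm k
        (c := fun i => complexResidue (restrictedDirichlet b A) (latticePoint b A i k))
        fun i hi => ?_⟩
      obtain ⟨c, hc⟩ := ih i hi
      simpa only [hc.complexResidue_eq] using hc

theorem complexResidue_restrictedDirichlet (hb : 1 < b) (hAb : ∀ a ∈ A, a < b)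
    (hA : A.Nonempty) {m : ℕ} (hm : m ≠ 0) (k : ℤ) :
    complexResidue (restrictedDirichlet b A) (latticePoint b A m k) =
      (1 - (b : ℂ) ^ m)⁻¹ * ((b : ℂ) ^ m / A.card * ∑ j ∈ Finset.range m,
        shiftCoeff b A (latticePoint b A m k) (j + 1) *
          complexResidue (restrictedDirichlet b A) (latticePoint b A (m - (j + 1)) k)) :=
  (hasSimplePoleAt_latticePoint_of_lt hb hAb hA hm k
    (c := fun i => complexResidue (restrictedDirichlet b A) (latticePoint b A i k))
    fun i _ => hasSimplePoleAt_latticePoint hb hAb hA i k).complexResidue_eq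

/-- `-s_{m,k} - i = m - i - s_{0,k}` identifies the binomial coefficients, and `1 - b^(-m) = -(1 -
b^m) / b^m` turns the factor in front into `-1 / N`. -/
theorem complexResidue_recursion (hb : 1 < b) (hAb : ∀ a ∈ A, a < b)
    (hA : A.Nonempty) {m : ℕ} (hm : m ≠ 0) (k : ℤ) :
    (1 - 1 / (b : ℂ) ^ m) * complexResidue (restrictedDirichlet b A) (latticePoint b A m k) =
      -(1 / (A.card : ℂ)) * ∑ j ∈ Finset.Icc 1 m,
        (∏ i ∈ Finset.range j, ((m : ℂ) - (i : ℂ) - latticePoint b A 0 k)) / (j.factorial : ℂ) *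
          (digitPowerSum A j / (b : ℂ) ^ j) *
          complexResidue (restrictedDirichlet b A) (latticePoint b A (m - j) k) := by
  have hbm : (b : ℂ) ^ m ≠ 0 := pow_ne_zero _ (by exact_mod_cast (by positivity : b ≠ 0))
  have hD := one_sub_pow_ne_zero hb hm
  have hterm (j : ℕ) : shiftCoeff b A (latticePoint b A m k) j =
      (∏ i ∈ Finset.range j, ((m : ℂ) - (i : ℂ) - latticePoint b A 0 k)) / (j.factorial : ℂ) *
        (digitPowerSum A j / (b : ℂ) ^ j) := by
    rw [shiftCoeff, chooseNeg]
    congr 2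
    refine Finset.prod_congr rfl fun i _ => ?_
    rw [latticePoint, latticePoint, Nat.cast_zero]
    ring
  simp only [← hterm]
  rw [complexResidue_restrictedDirichlet hb hAb hA hm, Finset.range_eq_Ico,
    Finset.sum_Ico_add' (fun j => shiftCoeff b A (latticePoint b A m k) j *
      complexResidue (restrictedDirichlet b A) (latticePoint b A (m - j) k)) 0 m 1, zero_add,
    Finset.Ico_add_one_right_eq_Icc]
  generalize (∑ j ∈ Finset.Icc 1 m, _ : ℂ) = S
  have e : (1 - 1 / (b : ℂ) ^ m) = -(1 - (b : ℂ) ^ m) / (b : ℂ) ^ m := by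
    field_simp
    ring
  rw [e]
  field_simp

theorem complexResidue_eq_zero_of_zero (hb : 1 < b) (hAb : ∀ a ∈ A, a < b)
    (hA : A.Nonempty) {k : ℤ}
    (h : complexResidue (restrictedDirichlet b A) (latticePoint b A 0 k) = 0) (m : ℕ) :
    complexResidue (restrictedDirichlet b A) (latticePoint b A m k) = 0 := by
  induction m using Nat.strong_induction_on with
  | _ m ih =>
    rcases eq_or_ne m 0 with rfl | hm
    · exact h
    · rw [complexResidue_restrictedDirichlet hb hAb hA hm, Finset.sum_eq_zero, mul_zero, mul_zero]
      intro j _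
      rw [ih _ (by omega), mul_zero]

/-- Both functions are the sum of the series near `s₀ + 1`. Only punctured neighbourhoods can be
claimed, since meromorphy leaves values at isolated points free. -/
theorem IsRestrictedDirichlet.eventuallyEq (hb : 1 < b) (hAb : ∀ a ∈ A, a < b)
    (hA : A.Nonempty) {K : ℂ → ℂ} (hK : IsRestrictedDirichlet b A K) (z : ℂ) :
    K =ᶠ[𝓝[≠] z] restrictedDirichlet b A := by
  have hK₀ := isRestrictedDirichlet_restrictedDirichlet hb hAb hA
  refine hK.meromorphic.eventuallyEq_nhdsNE hK₀.meromorphic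
    (z₀ := ((abscissa b A + 1 : ℝ) : ℂ)) ?_ z
  have hU : IsOpen {s : ℂ | abscissa b A < s.re} :=
    isOpen_lt continuous_const Complex.continuous_re
  filter_upwards [hU.mem_nhds (show abscissa b A < _ by
    rw [Complex.ofReal_re]; exact lt_add_one _)] with s hs
  exact (hK.hasSum s hs).unique (hK₀.hasSum s hs)

end Residues

theorem mainTheorem7 (b : ℕ) (hb : 1 < b) (A : Finset ℕ) (hAb : ∀ a ∈ A, a < b)
    (hA : ∃ a ∈ A, a ≠ 0) :
    (∃ K : ℂ → ℂ, IsRestrictedDirichlet b A K) ∧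
    ∀ K : ℂ → ℂ, IsRestrictedDirichlet b A K →
      (∀ (m : ℕ) (k : ℤ), 1 ≤ m →
        (1 - 1 / (b : ℂ) ^ m) * complexResidue K (latticePoint b A m k) =
          -(1 / (A.card : ℂ)) * ∑ j ∈ Finset.Icc 1 m,
            (∏ i ∈ Finset.range j, ((m : ℂ) - (i : ℂ) - latticePoint b A 0 k)) /
                (j.factorial : ℂ) *
              (digitPowerSum A j / (b : ℂ) ^ j) *
              complexResidue K (latticePoint b A (m - j) k)) ∧
      (∀ k : ℤ, complexResidue K (latticePoint b A 0 k) = 0 ↔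
        ¬ IsPoleOf K (latticePoint b A 0 k)) ∧
      (∀ k : ℤ, complexResidue K (latticePoint b A 0 k) = 0 →
        ∀ m : ℕ, 1 ≤ m → ¬ IsPoleOf K (latticePoint b A m k)) := by
  have hA' : A.Nonempty := hA.imp fun _ h => h.1
  refine ⟨⟨_, isRestrictedDirichlet_restrictedDirichlet hb hAb hA'⟩, fun K hK => ?_⟩
  -- This one fact rewrites every residue of `K` as that of the constructed continuation, and every
  -- pole condition as nonvanishing of that residue.
  have hpole (m : ℕ) (k : ℤ) : HasSimplePoleAt K (latticePoint b A m k)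
      (complexResidue (restrictedDirichlet b A) (latticePoint b A m k)) :=
    (hasSimplePoleAt_latticePoint hb hAb hA' m k).congr (hK.eventuallyEq hb hAb hA' _)
  simp only [fun m k => (hpole m k).complexResidue_eq, fun m k => (hpole m k).isPoleOf_iff, not_not]
  exact ⟨fun m k hm => complexResidue_recursion hb hAb hA' (by omega) k, fun _ => trivial,
    fun k h m _ => complexResidue_eq_zero_of_zero hb hAb hA' h m⟩
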